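/- Mean Value Theorem. Let $n\ge 0$ and let $\mathcal{C}\ell_n$ be the real Clifford algebra with generators $e_1,\dots,e_n$ and relations $e_ie_j+e_je_i=-2\delta_{ij}$; it is a finite-dimensional real vector space, with its usual topology. Let $M:\mathcal{C}\ell_n\to\mathcal{C}\ell_n$ be a bounded real-linear operator with $M(e_ja)=e_jM(a)$ for all $j$ and all $a\in\mathcal{C}\ell_n$ (for instance the multiplication $M_\lambda:a\mapsto a\lambda$ from the right by a Clifford number $\lambda$). For an open set $\Omega\subset\mathbb{R}^{n+1}$, with coordinates $y=(y_0,y_1,\dots,y_n)$, let $\mathcal{M}_M(\Omega)$ be the set of functions $f$ with values in $\mathcal{C}\ell_n$ that are continuous on the closure $\overline\Omega$, continuously differentiable in $\Omega$, and satisfy in $\Omega$ $$\frac{\partial f}{\partial y_0}=\Big(\sum_{j=1}^n e_j\frac{\partial}{\partial y_j}+M\Big)f .$$ Let $f\in\mathcal{M}_M(\Omega)$. Then for all $x\in\Omega$ and $R>0$ such that the open ball $\mathbb{B}(x,R)$ is contained in $\Omega$, the function $y\mapsto e^{-y_0M}f(y)$ is integrable on $\mathbb{B}(x,R)$ and $$f(x)=e^{x_0M}\,\frac{(n+1)\,\Gamma\!\left(\frac{n+1}{2}\right)}{2R^{n+1}\pi^{(n+1)/2}}\int_{\mathbb{B}(x,R)}e^{-y_0M}f(y)\,dy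 .$$ -/

import Mathlib

/-- The quadratic form `v ↦ -∑ j, v j ^ 2` on `ℝⁿ`. -/
noncomputable def negEuclideanForm (n : ℕ) : QuadraticForm ℝ (Fin n → ℝ) :=
  QuadraticMap.weightedSumSquares ℝ (fun _ : Fin n => (-1 : ℝ))

/-- The real Clifford algebra with generators `e_1, …, e_n` subject to
`e_i e_j + e_j e_i = -2 δ_ij`. -/
abbrev RealClifford (n : ℕ) : Type := CliffordAlgebra (negEuclideanForm n)

namespace RealClifford

/-- The generator `e_(j+1)`, for `j = 0, …, n - 1`. -/
noncomputable def gen {n : ℕ} (j : Fin n) : RealClifford n :=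
  CliffordAlgebra.ι (negEuclideanForm n) (Pi.single j 1)

/-- The linear coordinates of a Clifford number in the basis indexed by the subsets of
`{1, …, n}` (of dimension `2 ^ n`), coming from the linear isomorphism of the Clifford algebra
with the exterior algebra. -/
noncomputable def coords (n : ℕ) :
    RealClifford n ≃ₗ[ℝ] EuclideanSpace ℝ (Finset (Fin n)) :=
  (CliffordAlgebra.equivExterior (negEuclideanForm n)).trans
    ((Pi.basisFun ℝ (Fin n)).ExteriorAlgebra.equivFun.trans
      (WithLp.linearEquiv 2 ℝ (Finset (Fin n) → ℝ)).symm)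

/-- The Euclidean norm of the coordinates. The algebra is finite-dimensional, so every norm gives
the same topology, the same derivatives and the same integrals. -/
noncomputable instance instNormedAddCommGroup (n : ℕ) : NormedAddCommGroup (RealClifford n) :=
  NormedAddCommGroup.induced (RealClifford n) (EuclideanSpace ℝ (Finset (Fin n)))
    (coords n) (coords n).injective

noncomputable instance instNormedSpace (n : ℕ) : NormedSpace ℝ (RealClifford n) :=
  NormedSpace.induced ℝ (RealClifford n) (EuclideanSpace ℝ (Finset (Fin n)))
    (coords n)

end RealClifford

/-- The partial derivative `∂f/∂y_i` at `y ∈ ℝⁿ⁺¹`; the coordinates are `y_0, y_1, …, y_n`. -/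
noncomputable def partialDeriv {n : ℕ} (i : Fin (n + 1))
    (f : EuclideanSpace ℝ (Fin (n + 1)) → RealClifford n)
    (y : EuclideanSpace ℝ (Fin (n + 1))) : RealClifford n :=
  fderiv ℝ f y (EuclideanSpace.single i 1)

/-- The space `M_M(Ω)`: the functions continuous on the closure of `Ω` which are classical (`C¹`)
solutions in `Ω` of `∂f/∂y_0 = (∑ j, e_j ∂/∂y_j + M) f`. -/
def massSolutions {n : ℕ} (M : RealClifford n →L[ℝ] RealClifford n)
    (Ω : Set (EuclideanSpace ℝ (Fin (n + 1)))) :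
    Set (EuclideanSpace ℝ (Fin (n + 1)) → RealClifford n) :=
  {f | ContinuousOn f (closure Ω) ∧ ContDiffOn ℝ 1 f Ω ∧
    ∀ y ∈ Ω, partialDeriv 0 f y =
      (∑ j : Fin n, RealClifford.gen j * partialDeriv j.succ f y) + M (f y)}

/-! Put `G y = exp(-y₀M) f y`. As `M` commutes with each `e_j`, the factor absorbs the `M`-term and
`G` satisfies `∂₀G - ∑ e_j ∂_jG = 0`; the claim is the mean value property of `G`. This operator is
half of a factorisation of the Laplacian, but `G` is only known to be `C¹`, so harmonicity is
bypassed.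

Let `φ r` be the integral of `G (x + r z)` over the unit ball. Then `φ' r = ∑ I i i`, where `I i j`
is the integral of `z_i ∂_jG (x + r z)`. Rotation invariance makes `I` symmetric, and the equation
with its conjugate coefficients then kills the trace (`setIntegral_ball_fderiv_radial_eq_zero`).
Hence `φ R = φ 0`. -/

open MeasureTheory Metric Set Filter Topology in
theorem hasDerivAt_setIntegral_ball_comp {V F : Type*} [NormedAddCommGroup V] [NormedSpace ℝ V]
    [FiniteDimensional ℝ V] [MeasurableSpace V] [BorelSpace V] (μ : Measure V)
    [IsFiniteMeasureOnCompacts μ] [NormedAddCommGroup F] [NormedSpace ℝ F]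
    {G : V → F} {U K : Set V} (hU : IsOpen U) (hG : ContDiffOn ℝ 1 G U) (hK : IsCompact K)
    (hKU : K ⊆ U) (x : V) {T T' : ℝ → V →L[ℝ] V} (hT : ∀ t, HasDerivAt T (T' t) t)
    (hT' : Continuous T') (t₀ : ℝ)
    (hTK : ∀ᶠ t in 𝓝 t₀, ∀ z ∈ closedBall (0 : V) 1, x + T t z ∈ K) :
    HasDerivAt (fun t => ∫ z in ball (0 : V) 1, G (x + T t z) ∂μ)
      (∫ z in ball (0 : V) 1, fderiv ℝ G (x + T t₀ z) (T' t₀ z) ∂μ) t₀ := by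
  have hD : ContinuousOn (fderiv ℝ G) U := hG.continuousOn_fderiv_of_isOpen hU le_rfl
  obtain ⟨C₁, hC₁⟩ := hK.exists_bound_of_continuousOn (hD.mono hKU)
  -- Together with the bound `C₁` of the derivative on `K`, this gives a constant dominating
  -- function near `t₀`.
  have hbd : ∀ᶠ t in 𝓝 t₀, ‖T' t‖ < ‖T' t₀‖ + 1 :=
    hT'.norm.continuousAt.eventually_lt continuousAt_const (lt_add_one _)
  have hcont : ∀ t, (∀ z ∈ closedBall (0 : V) 1, x + T t z ∈ K) →
      ContinuousOn (fun z => G (x + T t z)) (closedBall 0 1) := fun t ht =>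
    (hG.continuousOn.mono hKU).comp (by fun_prop) ht
  have hfin : IsFiniteMeasure (μ.restrict (ball (0 : V) 1)) :=
    by
    constructor
    simpa using (measure_mono ball_subset_closedBall).trans_lt
      ((isCompact_closedBall (0 : V) 1).measure_lt_top (μ := μ))
  refine (hasDerivAt_integral_of_dominated_loc_of_deriv_le
    (F := fun t z => G (x + T t z)) (F' := fun t z => fderiv ℝ G (x + T t z) (T' t z))
    (bound := fun _ => C₁ * (‖T' t₀‖ + 1)) (hTK.and hbd) ?_ ?_ ?_ ?_
    (integrable_const _) ?_).2
  · filter_upwards [hTK] with t ht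
    exact ((hcont t ht).mono ball_subset_closedBall).aestronglyMeasurable measurableSet_ball
  · exact ((hcont t₀ hTK.self_of_nhds).integrableOn_compact (isCompact_closedBall 0 1)).mono_set
      ball_subset_closedBall
  · refine ContinuousOn.aestronglyMeasurable ?_ measurableSet_ball
    refine ContinuousOn.clm_apply ((hD.mono hKU).comp (by fun_prop) fun z hz =>
      hTK.self_of_nhds z (ball_subset_closedBall hz)) (by fun_prop)
  · refine (ae_restrict_iff' measurableSet_ball).2 (.of_forall fun z hz t ht => ?_)
    have h1 := hC₁ _ (ht.1 z (ball_subset_closedBall hz))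
    have h2 : ‖T' t z‖ ≤ ‖T' t₀‖ + 1 :=
      ((T' t).le_opNorm_of_le (mem_ball_zero_iff.1 hz).le).trans (by simpa using ht.2.le)
    exact ((fderiv ℝ G (x + T t z)).le_opNorm _).trans
      (mul_le_mul h1 h2 (norm_nonneg _) ((norm_nonneg _).trans h1))
  · refine (ae_restrict_iff' measurableSet_ball).2 (.of_forall fun z hz t ht => ?_)
    have hm : x + T t z ∈ U := hKU (ht.1 z (ball_subset_closedBall hz))
    have h1 : HasDerivAt (fun t => x + T t z) (T' t z) t := by
      simpa using ((hT t).clm_apply (hasDerivAt_const t z)).const_add x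
    exact ((hG.differentiableOn one_ne_zero).differentiableAt
      (hU.mem_nhds hm)).hasFDerivAt.comp_hasDerivAt t h1

/-! ### Rotation invariance of integrals over the ball -/

section PlaneRotation

variable {V : Type*} [NormedAddCommGroup V] [InnerProductSpace ℝ V]

open scoped RealInnerProductSpace

/-- The quarter turn of the plane spanned by the orthonormal pair `u`, `v`, zero on the
orthogonal complement. -/
noncomputable def planeTurn (u v : V) : V →L[ℝ] V :=
  (innerSL ℝ u).smulRight v - (innerSL ℝ v).smulRight u

/-- The rotation by the angle `θ` in the plane spanned by the orthonormal pair `u`, `v`. -/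
noncomputable def planeRotation (u v : V) (θ : ℝ) : V →L[ℝ] V :=
  ContinuousLinearMap.id ℝ V +
    (Real.cos θ - 1) • ((innerSL ℝ u).smulRight u + (innerSL ℝ v).smulRight v) +
    Real.sin θ • planeTurn u v

theorem norm_planeRotation {u v : V} (hu : ‖u‖ = 1) (hv : ‖v‖ = 1) (huv : ⟪u, v⟫ = 0) (θ : ℝ)
    (z : V) : ‖planeRotation u v θ z‖ = ‖z‖ := by
  have huu : ⟪u, u⟫ = 1 := by rw [real_inner_self_eq_norm_sq, hu, one_pow]
  have hvv : ⟪v, v⟫ = 1 := by rw [real_inner_self_eq_norm_sq, hv, one_pow]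
  have hvu : ⟪v, u⟫ = 0 := by rw [real_inner_comm, huv]
  have hzu : ⟪z, u⟫ = ⟪u, z⟫ := real_inner_comm _ _
  have hzv : ⟪z, v⟫ = ⟪v, z⟫ := real_inner_comm _ _
  refine (sq_eq_sq₀ (norm_nonneg _) (norm_nonneg _)).1 ?_
  rw [← real_inner_self_eq_norm_sq, ← real_inner_self_eq_norm_sq]
  simp only [planeRotation, planeTurn, add_apply, sub_apply,
    smul_apply, ContinuousLinearMap.smulRight_apply, innerSL_apply_apply,
    ContinuousLinearMap.id_apply, inner_add_left, inner_add_right, inner_sub_left, inner_sub_right,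
    real_inner_smul_left, real_inner_smul_right, huu, hvv, huv, hvu, hzu, hzv]
  linear_combination (⟪u, z⟫ ^ 2 + ⟪v, z⟫ ^ 2) * Real.sin_sq_add_cos_sq θ

theorem hasDerivAt_planeRotation (u v : V) (θ : ℝ) :
    HasDerivAt (planeRotation u v)
      (-Real.sin θ • ((innerSL ℝ u).smulRight u + (innerSL ℝ v).smulRight v) +
        Real.cos θ • planeTurn u v) θ := by
  have h1 := (((Real.hasDerivAt_cos θ).sub_const 1).smul_const
    ((innerSL ℝ u).smulRight u + (innerSL ℝ v).smulRight v)).const_add (ContinuousLinearMap.id ℝ V)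
  exact h1.add ((Real.hasDerivAt_sin θ).smul_const (planeTurn u v))

open MeasureTheory Metric in
theorem setIntegral_ball_comp_planeRotation {F : Type*} [NormedAddCommGroup F] [NormedSpace ℝ F]
    [FiniteDimensional ℝ V] [MeasurableSpace V] [BorelSpace V] {u v : V} (hu : ‖u‖ = 1)
    (hv : ‖v‖ = 1) (huv : ⟪u, v⟫ = 0) (θ : ℝ) (H : V → F) :
    ∫ z in ball (0 : V) 1, H (planeRotation u v θ z) = ∫ z in ball (0 : V) 1, H z := by
  let e : V ≃ₗᵢ[ℝ] V := LinearIsometry.toLinearIsometryEquiv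
    ⟨(planeRotation u v θ).toLinearMap, norm_planeRotation hu hv huv θ⟩ rfl
  have he : ⇑e = planeRotation u v θ := rfl
  have h := e.measurePreserving.setIntegral_preimage_emb
    e.toHomeomorph.measurableEmbedding H (ball 0 1)
  rwa [e.preimage_ball, map_zero, he] at h

-- The integral of `G (x + r • z)` is unchanged when `z` is rotated; differentiating in the angle at
-- `0` gives `r` times this integral.
open MeasureTheory Metric in
theorem setIntegral_ball_fderiv_planeTurn {F : Type*} [NormedAddCommGroup F] [NormedSpace ℝ F]
    [FiniteDimensional ℝ V] [MeasurableSpace V] [BorelSpace V] {u v : V} (hu : ‖u‖ = 1)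
    (hv : ‖v‖ = 1) (huv : ⟪u, v⟫ = 0) {G : V → F} {U : Set V} (hU : IsOpen U)
    (hG : ContDiffOn ℝ 1 G U) (x : V) {r : ℝ} (hr : 0 < r) (hrU : closedBall x r ⊆ U) :
    ∫ z in ball (0 : V) 1, fderiv ℝ G (x + r • z) (planeTurn u v z) = 0 := by
  have h := hasDerivAt_setIntegral_ball_comp volume hU hG (isCompact_closedBall x r) hrU x
    (T := fun θ => r • planeRotation u v θ)
    (fun θ => (hasDerivAt_planeRotation u v θ).const_smul r) (by fun_prop) 0
    (.of_forall fun θ z hz => by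
      simpa [norm_smul, abs_of_pos hr, norm_planeRotation hu hv huv] using
        mul_le_of_le_one_right hr.le (mem_closedBall_zero_iff.1 hz))
  have hc : (fun θ => ∫ z in ball (0 : V) 1, G (x + (r • planeRotation u v θ) z)) =
      fun _ => ∫ z in ball (0 : V) 1, G (x + r • z) := by
    funext θ
    exact setIntegral_ball_comp_planeRotation hu hv huv θ fun z => G (x + r • z)
  rw [hc] at h
  have h0 := h.unique (hasDerivAt_const _ _)
  have hz : ∀ z : V, planeRotation u v 0 z = z := fun z => by simp [planeRotation]
  simpa [hz, integral_smul, hr.ne'] using h0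

end PlaneRotation

/-! ### Mean value property for operators of Dirac type -/

open MeasureTheory Metric in
theorem setIntegral_ball_fderiv_radial_eq_zero {ι F : Type*} [Fintype ι] [DecidableEq ι]
    [NormedAddCommGroup F] [NormedSpace ℝ F] [CompleteSpace F] {A B : ι → F →L[ℝ] F}
    (hBA : ∀ i j a, B i (A j a) + B j (A i a) = if i = j then (2 : ℝ) • a else 0)
    {G : EuclideanSpace ℝ ι → F} {U : Set (EuclideanSpace ℝ ι)} (hU : IsOpen U)
    (hG : ContDiffOn ℝ 1 G U)
    (hDG : ∀ y ∈ U, ∑ i, A i (fderiv ℝ G y (EuclideanSpace.single i 1)) = 0)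
    (x : EuclideanSpace ℝ ι) {r : ℝ} (hr : 0 < r) (hrU : closedBall x r ⊆ U) :
    ∫ z in ball (0 : EuclideanSpace ℝ ι) 1, fderiv ℝ G (x + r • z) z = 0 := by
  have hmem : ∀ z ∈ closedBall (0 : EuclideanSpace ℝ ι) 1, x + r • z ∈ U := fun z hz =>
    hrU (by simpa [norm_smul, abs_of_pos hr] using
      mul_le_of_le_one_right hr.le (mem_closedBall_zero_iff.1 hz))
  have hD : ContinuousOn (fun z => fderiv ℝ G (x + r • z)) (closedBall 0 1) :=
    (hG.continuousOn_fderiv_of_isOpen hU le_rfl).comp (by fun_prop) hmem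
  have hint : ∀ i j, IntegrableOn
      (fun z : EuclideanSpace ℝ ι => z i • fderiv ℝ G (x + r • z) (EuclideanSpace.single j 1))
      (ball 0 1) := fun i j =>
    (ContinuousOn.integrableOn_compact (isCompact_closedBall 0 1)
      (ContinuousOn.smul (by fun_prop) (hD.clm_apply continuousOn_const))).mono_set
      ball_subset_closedBall
  set I : ι → ι → F := fun i j => ∫ z in ball (0 : EuclideanSpace ℝ ι) 1,
    z i • fderiv ℝ G (x + r • z) (EuclideanSpace.single j 1) with hI
  -- The quarter turn in the `(i, j)` plane sends `z` to `z_i e_j - z_j e_i`, so its vanishing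
  -- integral is `I i j - I j i`.
  have hsymm : ∀ i j, I i j = I j i := by
    intro i j
    rcases eq_or_ne i j with rfl | hij
    · rfl
    have h := setIntegral_ball_fderiv_planeTurn (u := EuclideanSpace.single i (1 : ℝ))
      (v := EuclideanSpace.single j (1 : ℝ)) (by simp) (by simp)
      (by simp [EuclideanSpace.inner_single_left, hij]) hU hG x hr hrU
    rw [← sub_eq_zero, ← h, hI, ← integral_sub (hint i j) (hint j i)]
    simp [planeTurn, EuclideanSpace.inner_single_left]
  -- The equation multiplied by `z_i` and integrated.
  have hA : ∀ i, ∑ j, A j (I i j) = 0 := by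
    intro i
    simp only [hI, ← (A _).integral_comp_comm (hint i _)]
    rw [← integral_finsetSum _ fun j _ => (A j).integrable_comp (hint i j)]
    refine setIntegral_eq_zero_of_forall_eq_zero fun z hz => ?_
    simp only [map_smul, ← Finset.smul_sum]
    rw [hDG _ (hmem z (ball_subset_closedBall hz)), smul_zero]
  have hBA0 : ∑ i, ∑ j, B i (A j (I i j)) = 0 := by
    simp only [← map_sum, hA, map_zero, Finset.sum_const_zero]
  -- By symmetry of `I`, the sum of `B i (A j (I i j))` only sees `B i A j + B j A i`, which is
  -- twice the Kronecker delta.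
  have htr : (2 : ℝ) • ∑ i, I i i = 0 := by
    calc (2 : ℝ) • ∑ i, I i i = ∑ i, ∑ j, (B i (A j (I i j)) + B j (A i (I i j))) := by
          simp [hBA, Finset.smul_sum]
      _ = ∑ i, ∑ j, B i (A j (I i j)) + ∑ i, ∑ j, B j (A i (I i j)) := by
          simp only [Finset.sum_add_distrib]
      _ = 0 := by
          rw [hBA0, Finset.sum_comm, zero_add, ← hBA0]
          simp only [hsymm]
  have htr' : ∑ i, I i i = 0 := (smul_eq_zero.1 htr).resolve_left two_ne_zero
  rw [← htr', hI, ← integral_finsetSum _ fun i _ => hint i i]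
  refine integral_congr_ae (.of_forall fun z => ?_)
  have hz : z = ∑ i, z i • EuclideanSpace.single i (1 : ℝ) := by
    ext k; simp [Pi.single_apply]
  calc fderiv ℝ G (x + r • z) z
      = fderiv ℝ G (x + r • z) (∑ i, z i • EuclideanSpace.single i (1 : ℝ)) := by rw [← hz]
    _ = _ := by simp only [map_sum, map_smul]

open MeasureTheory Metric Filter Topology Set in
theorem setIntegral_unitBall_comp_of_dirac {ι F : Type*} [Fintype ι] [DecidableEq ι]
    [NormedAddCommGroup F] [NormedSpace ℝ F] [CompleteSpace F] {A B : ι → F →L[ℝ] F}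
    (hBA : ∀ i j a, B i (A j a) + B j (A i a) = if i = j then (2 : ℝ) • a else 0)
    {G : EuclideanSpace ℝ ι → F} {x : EuclideanSpace ℝ ι} {R : ℝ} (hR : 0 < R)
    (hGc : ContinuousOn G (closedBall x R)) (hG : ContDiffOn ℝ 1 G (ball x R))
    (hDG : ∀ y ∈ ball x R, ∑ i, A i (fderiv ℝ G y (EuclideanSpace.single i 1)) = 0) :
    ∫ z in ball (0 : EuclideanSpace ℝ ι) 1, G (x + R • z) =
      volume.real (ball (0 : EuclideanSpace ℝ ι) 1) • G x := by
  have hmem : ∀ r ∈ Icc 0 R, ∀ z ∈ closedBall (0 : EuclideanSpace ℝ ι) 1,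
      x + r • z ∈ closedBall x R := fun r hr z hz => by
    simpa [norm_smul, abs_of_nonneg hr.1] using
      (mul_le_of_le_one_right hr.1 (mem_closedBall_zero_iff.1 hz)).trans hr.2
  obtain ⟨C, hC⟩ := (isCompact_closedBall x R).exists_bound_of_continuousOn hGc
  have hcont : ContinuousOn (fun r : ℝ => ∫ z in ball (0 : EuclideanSpace ℝ ι) 1, G (x + r • z))
      (Icc 0 R) := by
    refine continuousOn_of_dominated (bound := fun _ => C) (fun r hr => ?_) (fun r hr => ?_)
      (integrableOn_const measure_ball_lt_top.ne) ?_
    · exact ContinuousOn.aestronglyMeasurable (hGc.comp (by fun_prop) fun z hz =>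
        hmem r hr z (ball_subset_closedBall hz)) measurableSet_ball
    · exact (ae_restrict_iff' measurableSet_ball).2 (.of_forall fun z hz =>
        hC _ (hmem r hr z (ball_subset_closedBall hz)))
    · exact (ae_restrict_iff' measurableSet_ball).2 (.of_forall fun z hz =>
        hGc.comp (by fun_prop) fun r hr => hmem r hr z (ball_subset_closedBall hz))
  have hderiv : ∀ r ∈ Ioo 0 R, HasDerivAt
      (fun r : ℝ => ∫ z in ball (0 : EuclideanSpace ℝ ι) 1, G (x + r • z)) 0 r := by
    intro r hr
    -- `G` is `C¹` only in the open ball; the closed ball of radius `s` is the compact set on which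
    -- its derivative is bounded.
    obtain ⟨s, hrs, hsR⟩ := exists_between hr.2
    have hT : ∀ t : ℝ, HasDerivAt
        (fun t : ℝ => t • ContinuousLinearMap.id ℝ (EuclideanSpace ℝ ι))
        (ContinuousLinearMap.id ℝ (EuclideanSpace ℝ ι)) t := fun t => by
      simpa using (hasDerivAt_id t).smul_const (ContinuousLinearMap.id ℝ (EuclideanSpace ℝ ι))
    have h := hasDerivAt_setIntegral_ball_comp volume isOpen_ball hG (isCompact_closedBall x s)
      (closedBall_subset_ball hsR) x
      (T := fun r : ℝ => r • ContinuousLinearMap.id ℝ (EuclideanSpace ℝ ι))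
      (T' := fun _ => ContinuousLinearMap.id ℝ (EuclideanSpace ℝ ι))
      hT continuous_const r (by
        filter_upwards [Ioo_mem_nhds hr.1 hrs] with t ht z hz
        simpa [norm_smul, abs_of_pos ht.1] using
          (mul_le_of_le_one_right ht.1.le (mem_closedBall_zero_iff.1 hz)).trans ht.2.le)
    have h0 := setIntegral_ball_fderiv_radial_eq_zero hBA isOpen_ball hG hDG x hr.1
      (closedBall_subset_ball hr.2)
    simpa [h0] using h
  -- The derivative is known only inside `(0, R)`; continuity covers the endpoint `R` here, and `0`
  -- by the limit below.
  have hconst : ∀ r ∈ Ioo 0 R, ∫ z in ball (0 : EuclideanSpace ℝ ι) 1, G (x + r • z) =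
      ∫ z in ball (0 : EuclideanSpace ℝ ι) 1, G (x + R • z) := fun r hr =>
    (constant_of_has_deriv_right_zero (hcont.mono (Icc_subset_Icc_left hr.1.le))
      (fun t ht => (hderiv t ⟨hr.1.trans_le ht.1, ht.2⟩).hasDerivWithinAt) R
      ⟨hr.2.le, le_rfl⟩).symm
  have hlim := (hcont 0 ⟨le_rfl, hR.le⟩).mono_left (nhdsWithin_mono 0 Ioo_subset_Icc_self)
  have : (𝓝[Ioo 0 R] (0 : ℝ)).NeBot := left_nhdsWithin_Ioo_neBot hR
  have h := tendsto_nhds_unique hlim (tendsto_const_nhds.congr'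
    (eventually_nhdsWithin_of_forall fun r hr => (hconst r hr).symm))
  simpa using h.symm

open MeasureTheory Metric in
/-- The mean value property of the null solutions of an operator of Dirac type. -/
theorem setIntegral_ball_of_dirac {ι F : Type*} [Fintype ι] [DecidableEq ι]
    [NormedAddCommGroup F] [NormedSpace ℝ F] [CompleteSpace F] {A B : ι → F →L[ℝ] F}
    (hBA : ∀ i j a, B i (A j a) + B j (A i a) = if i = j then (2 : ℝ) • a else 0)
    {G : EuclideanSpace ℝ ι → F} {x : EuclideanSpace ℝ ι} {R : ℝ} (hR : 0 < R)
    (hGc : ContinuousOn G (closedBall x R)) (hG : ContDiffOn ℝ 1 G (ball x R))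
    (hDG : ∀ y ∈ ball x R, ∑ i, A i (fderiv ℝ G y (EuclideanSpace.single i 1)) = 0) :
    ∫ y in ball x R, G y = volume.real (ball x R) • G x := by
  have h := setIntegral_unitBall_comp_of_dirac hBA hR hGc hG hDG
  have htrans := (measurePreserving_add_left volume x).setIntegral_preimage_emb
    (measurableEmbedding_addLeft x) G (ball x R)
  have hscale := Measure.setIntegral_comp_smul_of_pos volume (fun z => G (x + z)) (ball 0 1) hR
  rw [smul_unitBall_of_pos hR, h] at hscale
  rw [preimage_add_ball, sub_self] at htrans
  rw [← htrans, measureReal_def, Measure.addHaar_ball_of_pos _ _ hR, ENNReal.toReal_mul,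
    ← measureReal_def, ENNReal.toReal_ofReal (by positivity), mul_smul, hscale, smul_smul,
    mul_inv_cancel₀ (by positivity), one_smul]

/-! ### The Clifford algebra and the exponential substitution -/

namespace RealClifford

instance instFiniteDimensional (n : ℕ) : FiniteDimensional ℝ (RealClifford n) :=
  (coords n).symm.finiteDimensional

instance instCompleteSpace (n : ℕ) : CompleteSpace (RealClifford n) :=
  FiniteDimensional.complete ℝ _

theorem gen_mul_gen_add_swap {n : ℕ} (i j : Fin n) :
    (gen i * gen j + gen j * gen i : RealClifford n) =
      if i = j then algebraMap ℝ (RealClifford n) (-2) else 0 := by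
  have h : QuadraticMap.polar (negEuclideanForm n) (Pi.single i 1) (Pi.single j 1) =
      if i = j then -2 else 0 := by
    simp only [QuadraticMap.polar, negEuclideanForm, QuadraticMap.weightedSumSquares_apply,
      ← Finset.sum_sub_distrib, Pi.add_apply]
    have : ∀ k : Fin n, ((-1 : ℝ) • (((Pi.single i 1 : Fin n → ℝ) k + (Pi.single j 1 : Fin n → ℝ) k) *
        ((Pi.single i 1 : Fin n → ℝ) k + (Pi.single j 1 : Fin n → ℝ) k)) -
        (-1 : ℝ) • ((Pi.single i 1 : Fin n → ℝ) k * (Pi.single i 1 : Fin n → ℝ) k) -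
        (-1 : ℝ) • ((Pi.single j 1 : Fin n → ℝ) k * (Pi.single j 1 : Fin n → ℝ) k)) =
        if i = k then (if i = j then -2 else 0) else 0 := by
      intro k
      simp only [Pi.single_apply, smul_eq_mul, eq_comm (a := k)]
      split_ifs <;> first | (norm_num; done) | simp_all
    rw [Finset.sum_congr rfl fun k _ => this k]
    simp
  rw [gen, gen, CliffordAlgebra.ι_mul_ι_add_swap, h]
  split_ifs <;> simp

/-- Left multiplication by the `j`-th generator. -/
noncomputable def mulGen {n : ℕ} (j : Fin n) : RealClifford n →L[ℝ] RealClifford n :=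
  LinearMap.toContinuousLinearMap (LinearMap.mulLeft ℝ (gen j))

@[simp]
theorem mulGen_apply {n : ℕ} (j : Fin n) (a : RealClifford n) : mulGen j a = gen j * a := rfl

/-- The coefficients of the Cauchy-Riemann operator `∂_0 - ∑ j, e_j ∂_j`. -/
noncomputable def diracCoeff {n : ℕ} : Fin (n + 1) → RealClifford n →L[ℝ] RealClifford n :=
  Fin.cons (ContinuousLinearMap.id ℝ _) fun j => -mulGen j

/-- The coefficients of the conjugate operator `∂_0 + ∑ j, e_j ∂_j`. -/
noncomputable def diracConjCoeff {n : ℕ} : Fin (n + 1) → RealClifford n →L[ℝ] RealClifford n :=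
  Fin.cons (ContinuousLinearMap.id ℝ _) mulGen

/-- Polarised form of `(∂₀ + ∑ e_j ∂_j)(∂₀ - ∑ e_j ∂_j) = Δ`: mixed terms with index `0` cancel, the
others follow from the Clifford relations. -/
theorem diracConjCoeff_diracCoeff {n : ℕ} (i j : Fin (n + 1)) (a : RealClifford n) :
    diracConjCoeff i (diracCoeff j a) + diracConjCoeff j (diracCoeff i a) =
      if i = j then (2 : ℝ) • a else 0 := by
  cases i using Fin.cases with
  | zero =>
    cases j using Fin.cases with
    | zero => simp [diracCoeff, diracConjCoeff, two_smul]
    | succ j => simp [diracCoeff, diracConjCoeff, (Fin.succ_ne_zero j).symm]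
  | succ i =>
    cases j using Fin.cases with
    | zero => simp [diracCoeff, diracConjCoeff]
    | succ j =>
      have h := congrArg (fun c => -(c * a)) (gen_mul_gen_add_swap i j)
      simp only [add_mul, mul_assoc] at h
      simp only [diracCoeff, diracConjCoeff, Fin.cons_succ, neg_apply, mulGen_apply, mul_neg,
        ← neg_add, h, Fin.succ_inj]
      split_ifs
      · rw [← Algebra.smul_def, ← neg_smul, neg_neg]
      · simp

theorem gen_mul_exp_apply {n : ℕ} {M : RealClifford n →L[ℝ] RealClifford n}
    (hM : ∀ (j : Fin n) (a : RealClifford n), M (gen j * a) = gen j * M a) (t : ℝ) (j : Fin n)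
    (a : RealClifford n) :
    gen j * NormedSpace.exp (t • M) a = NormedSpace.exp (t • M) (gen j * a) := by
  have h : Commute (mulGen j) (t • M) :=
    Commute.smul_right (ContinuousLinearMap.ext fun a => (hM j a).symm) t
  exact congrArg (fun L : RealClifford n →L[ℝ] RealClifford n => L a) h.exp_right.eq

/-- Product rule; the extra term appears only along `y₀`, where it cancels the `M f` of the
equation. -/
theorem fderiv_exp_apply {n : ℕ} (M : RealClifford n →L[ℝ] RealClifford n)
    {f : EuclideanSpace ℝ (Fin (n + 1)) → RealClifford n} {y : EuclideanSpace ℝ (Fin (n + 1))}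
    (hf : DifferentiableAt ℝ f y) (v : EuclideanSpace ℝ (Fin (n + 1))) :
    fderiv ℝ (fun y => NormedSpace.exp (-(y 0) • M) (f y)) y v =
      NormedSpace.exp (-(y 0) • M) (fderiv ℝ f y v - v 0 • M (f y)) := by
  have h0 : HasFDerivAt (fun y : EuclideanSpace ℝ (Fin (n + 1)) => -(y 0))
      (-(EuclideanSpace.proj 0 : EuclideanSpace ℝ (Fin (n + 1)) →L[ℝ] ℝ)) y :=
    (EuclideanSpace.proj (𝕜 := ℝ) (0 : Fin (n + 1))).hasFDerivAt.neg
  have h1 := (hasDerivAt_exp_smul_const (𝕂 := ℝ) M (-(y 0))).hasFDerivAt.comp y h0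
  have h2 : HasFDerivAt (fun y => NormedSpace.exp (-(y 0) • M) (f y)) _ y :=
    HasFDerivAt.clm_apply h1 hf.hasFDerivAt
  rw [h2.fderiv]
  simp [sub_eq_add_neg]

end RealClifford

-- The ball has volume `π^s R^(n+1) / Γ(s+1)` with `s = (n+1)/2`, and `Γ(s+1) = s Γ(s)`.
open MeasureTheory Metric in
theorem volumeReal_ball_mul_meanValueConst (n : ℕ) (x : EuclideanSpace ℝ (Fin (n + 1))) {R : ℝ}
    (hR : 0 < R) :
    (((n : ℝ) + 1) * Real.Gamma (((n : ℝ) + 1) / 2)) /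
      (2 * R ^ (n + 1) * Real.pi ^ (((n : ℝ) + 1) / 2)) * volume.real (ball x R) = 1 := by
  have hn : (0 : ℝ) < ((n : ℝ) + 1) / 2 := by positivity
  have hG : Real.Gamma (((n : ℝ) + 1) / 2) ≠ 0 := (Real.Gamma_pos_of_pos hn).ne'
  have hpi : √Real.pi ^ (n + 1) = Real.pi ^ (((n : ℝ) + 1) / 2) := by
    rw [Real.sqrt_eq_rpow, ← Real.rpow_natCast, ← Real.rpow_mul Real.pi_pos.le]
    push_cast
    ring_nf
  have hp : Real.pi ^ (((n : ℝ) + 1) / 2) ≠ 0 := (Real.rpow_pos_of_pos Real.pi_pos _).ne'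
  rw [measureReal_def, EuclideanSpace.volume_ball, Fintype.card_fin, ENNReal.toReal_mul,
    ENNReal.toReal_pow, ENNReal.toReal_ofReal hR.le, ENNReal.toReal_ofReal
      (div_nonneg (by positivity) (Real.Gamma_nonneg_of_nonneg (by positivity))), hpi]
  push_cast
  rw [Real.Gamma_add_one hn.ne']
  field_simp

theorem mainTheorem9 (n : ℕ)
    (M : RealClifford n →L[ℝ] RealClifford n)
    (hM : ∀ (j : Fin n) (a : RealClifford n),
      M (RealClifford.gen j * a) = RealClifford.gen j * M a)
    (Ω : Set (EuclideanSpace ℝ (Fin (n + 1)))) (hΩ : IsOpen Ω)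
    (f : EuclideanSpace ℝ (Fin (n + 1)) → RealClifford n)
    (hf : f ∈ massSolutions M Ω)
    (x : EuclideanSpace ℝ (Fin (n + 1))) (R : ℝ) (hR : 0 < R)
    (hball : Metric.ball x R ⊆ Ω) :
    MeasureTheory.IntegrableOn (fun y => NormedSpace.exp (-(y 0) • M) (f y))
      (Metric.ball x R) MeasureTheory.volume ∧
    f x = NormedSpace.exp (x 0 • M)
      (((((n : ℝ) + 1) * Real.Gamma (((n : ℝ) + 1) / 2)) /
          (2 * R ^ (n + 1) * Real.pi ^ (((n : ℝ) + 1) / 2))) •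
        ∫ y in Metric.ball x R, NormedSpace.exp (-(y 0) • M) (f y)) := by
  obtain ⟨hfc, hf1, hfM⟩ := hf
  have hexp : ContDiff ℝ 1 fun y : EuclideanSpace ℝ (Fin (n + 1)) =>
      NormedSpace.exp (-(y 0) • M) :=
    (contDiff_iff_contDiffAt.2 fun L => (NormedSpace.exp_analytic (𝕂 := ℝ) L).contDiffAt).comp
      (by fun_prop)
  -- The closed ball may leave `Ω`; this is where continuity of `f` on the closure is needed.
  have hsub : Metric.closedBall x R ⊆ closure Ω := by
    rw [← closure_ball x hR.ne']
    exact closure_mono hball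
  have hGc : ContinuousOn (fun y => NormedSpace.exp (-(y 0) • M) (f y))
      (Metric.closedBall x R) :=
    hexp.continuous.continuousOn.clm_apply (hfc.mono hsub)
  have hG : ContDiffOn ℝ 1 (fun y => NormedSpace.exp (-(y 0) • M) (f y)) (Metric.ball x R) :=
    hexp.contDiffOn.clm_apply (hf1.mono hball)
  have hint := setIntegral_ball_of_dirac RealClifford.diracConjCoeff_diracCoeff hR hGc hG
    fun y hy => by
      have hd : DifferentiableAt ℝ f y :=
        (hf1.differentiableOn one_ne_zero).differentiableAt (hΩ.mem_nhds (hball hy))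
      have h := hfM y (hball hy)
      simp only [partialDeriv] at h
      simp only [RealClifford.fderiv_exp_apply M hd, Fin.sum_univ_succ,
        RealClifford.diracCoeff, Fin.cons_zero, Fin.cons_succ, ContinuousLinearMap.id_apply,
        neg_apply, RealClifford.mulGen_apply, RealClifford.gen_mul_exp_apply hM, ← map_neg,
        ← map_sum, ← map_add]
      rw [h]
      simp
  refine ⟨(hGc.integrableOn_compact (isCompact_closedBall x R)).mono_set
    Metric.ball_subset_closedBall, ?_⟩
  -- Scalar structure for `NormedSpace.exp_add_of_commute`, which makes the exponentials of `x₀M`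
  -- and `-x₀M` cancel.
  let _ := NormedAlgebra.restrictScalars ℚ ℝ (RealClifford n →L[ℝ] RealClifford n)
  rw [hint, smul_smul, volumeReal_ball_mul_meanValueConst n x hR, one_smul,
    ← mul_apply_eq_comp, ← NormedSpace.exp_add_of_commute
      ((Commute.refl M).smul_left _ |>.smul_right _), ← add_smul, add_neg_cancel, zero_smul,
    NormedSpace.exp_zero, one_apply_eq_self]
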